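/- Let $G$ be a locally compact (Hausdorff) group, let $C_c(G)$ be the space of continuous complex-valued functions on $G$ with compact support, and fix a left Haar measure $dq$ on $G$. For $f,g\in C_c(G)$ let $$(f*g)(p)=\int_G f(q)\,g(q^{-1}p)\,dq \qquad (p\in G).$$ A function $\xi\in C_c(G)$ is called *polynomial* if there are an open neighbourhood $V$ of the identity of $G$ and a finite-dimensional subspace $F$ of $C_c(G)$ such that for every $v\in V$ the function $p\mapsto \xi(pv)$ belongs to $F$. If $f,\xi\in C_c(G)$ satisfy $f*\xi=\xi$, then $\xi$ is polynomial. Moreover, if in addition $\xi\neq 0$, then $G$ has a compact open subgroup. -/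

import Mathlib

open scoped CompactlySupported

/-- The right translate `v · f : p ↦ f (p * v)` of a function `f ∈ C_c(G)`: the function `v · f`
induced by the (global) right action of `G` on itself by right multiplication. -/
noncomputable def rightTranslate {G : Type*} [Group G] [TopologicalSpace G] [IsTopologicalGroup G]
    (v : G) (f : C_c(G, ℂ)) : C_c(G, ℂ) where
  toFun p := f (p * v)
  continuous_toFun := f.continuous.comp (continuous_mul_const v)
  hasCompactSupport' := f.hasCompactSupport.comp_homeomorph (Homeomorph.mulRight v)

/-- A function `f ∈ C_c(G)` is *polynomial* (for the action of `G` on itself by right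
multiplication) if there are an open neighbourhood `V` of the identity and a finite-dimensional
subspace `F` of `C_c(G)` containing all the translates `v · f` with `v ∈ V`. The right action is
defined on all of `G × G`, so there is no further restriction on `V`. -/
def IsPolynomialFunction {G : Type*} [Group G] [TopologicalSpace G] [IsTopologicalGroup G]
    (f : C_c(G, ℂ)) : Prop :=
  ∃ V : Set G, IsOpen V ∧ (1 : G) ∈ V ∧
    ∃ F : Submodule ℂ C_c(G, ℂ), FiniteDimensional ℂ F ∧ ∀ v ∈ V, rightTranslate v f ∈ F

/-- The convolution `(f * g)(p) = ∫ f(q) g(q⁻¹ p) dq` of `f, g ∈ C_c(G)`, with respect to a left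
Haar measure `μ`. For every `p`, the integrand is continuous with compact support. -/
noncomputable def haarConvolution {G : Type*} [Group G] [TopologicalSpace G] [MeasurableSpace G]
    (μ : MeasureTheory.Measure G) (f g : C_c(G, ℂ)) : G → ℂ :=
  fun p => ∫ q, f q * g (q⁻¹ * p) ∂μ

open MeasureTheory Filter Topology Set
open scoped BoundedContinuousFunction Pointwise

/-! Convolution by `f` sends the sup-norm unit ball to an equicontinuous family, so by Arzelà–Ascoli
and Riesz the solutions of `f * η = η` supported in a fixed compact set form a finite-dimensional
space. Right translation commutes with `f * ·`, so this space contains all translates of `ξ` by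
small `v`: `ξ` is polynomial. If `ξ ≠ 0`, translates of `ξ` span a finite-dimensional `F` stable
under all small translations (`IsPolynomialFunction.exists_invariant_submodule`). The stabilizer of
`F` is then an open subgroup, and it is compact because the functions in `F` share a compact
support. -/

/-- A space of functions vanishing outside a fixed compact set is finite-dimensional if its unit
ball for the supremum norm is equicontinuous. -/
theorem finiteDimensional_of_equicontinuous_unitBall {X : Type*} [TopologicalSpace X]
    (E : Submodule ℂ C_c(X, ℂ)) {L : Set X} (hL : IsCompact L)
    (hsupp : ∀ η ∈ E, ∀ x ∉ L, η x = 0)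
    (hE : Equicontinuous
      (fun η : {η : C_c(X, ℂ) // η ∈ E ∧ ∀ x, ‖η x‖ ≤ 1} ↦ (η.1 : X → ℂ))) :
    FiniteDimensional ℂ E := by
  have : CompactSpace L := isCompact_iff_compactSpace.mp hL
  let R : E →ₗ[ℂ] (L →ᵇ ℂ) :=
    { toFun := fun η ↦ BoundedContinuousFunction.mkOfCompact
        ⟨fun x : L ↦ (η : C_c(X, ℂ)) x, (η : C_c(X, ℂ)).continuous.comp continuous_subtype_val⟩
      map_add' := fun _ _ ↦ rfl
      map_smul' := fun _ _ ↦ rfl }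
  have hR : ∀ (η : E) (x : L), R η x = (η : C_c(X, ℂ)) x := fun _ _ ↦ rfl
  have hinj : Function.Injective R := by
    intro η θ hηθ
    ext x
    by_cases hx : x ∈ L
    · exact DFunLike.congr_fun hηθ ⟨x, hx⟩
    · rw [hsupp _ η.2 x hx, hsupp _ θ.2 x hx]
  let A : Set (L →ᵇ ℂ) := R '' {η | ∀ x, ‖(η : C_c(X, ℂ)) x‖ ≤ 1}
  have hA : IsCompact (closure A) := by
    refine BoundedContinuousFunction.arzela_ascoli _ (isCompact_closedBall (0 : ℂ) 1) A ?_ ?_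
    · rintro _ x ⟨η, hη, rfl⟩
      simpa [hR] using hη x
    · intro x₀
      rw [Metric.equicontinuousAt_iff_right]
      intro ε hε
      have h := Metric.equicontinuousAt_iff_right.mp (hE x₀) ε hε
      filter_upwards [(continuous_subtype_val.tendsto x₀).eventually h] with x hx
      rintro ⟨_, η, hη, rfl⟩
      exact hx ⟨η, η.2, hη⟩
  have hball : TotallyBounded (Metric.closedBall (0 : LinearMap.range R) 1) := by
    refine (totallyBounded_preimage isUniformEmbedding_subtype_val.isUniformInducing
      (hA.totallyBounded.subset subset_closure)).subset ?_
    rintro ⟨_, η, rfl⟩ hη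
    refine ⟨η, fun x ↦ ?_, rfl⟩
    by_cases hx : x ∈ L
    · have h1 : ‖R η‖ ≤ 1 := mem_closedBall_zero_iff.mp hη
      exact ((R η).norm_coe_le_norm ⟨x, hx⟩).trans h1
    · rw [hsupp _ η.2 x hx, norm_zero]
      exact zero_le_one
  have : FiniteDimensional ℂ (LinearMap.range R) :=
    .of_totallyBounded_nhds_zero ℂ (Metric.closedBall_mem_nhds 0 one_pos) hball
  exact (LinearEquiv.ofInjective R hinj).symm.finiteDimensional

section Group

variable {G : Type*} [Group G] [TopologicalSpace G] [IsTopologicalGroup G]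

@[simp]
theorem rightTranslate_apply (v : G) (f : C_c(G, ℂ)) (p : G) :
    rightTranslate v f p = f (p * v) := rfl

theorem rightTranslate_mul (v w : G) (f : C_c(G, ℂ)) :
    rightTranslate (v * w) f = rightTranslate v (rightTranslate w f) := by
  ext p
  simp [mul_assoc]

theorem rightTranslate_one (f : C_c(G, ℂ)) : rightTranslate 1 f = f := by
  ext p
  simp

/-- Right translation by `v` as a linear map of `C_c(G)`. -/
noncomputable def rightTranslateLinearMap (v : G) : C_c(G, ℂ) →ₗ[ℂ] C_c(G, ℂ) where
  toFun := rightTranslate v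
  map_add' _ _ := rfl
  map_smul' _ _ := rfl

/-- The open neighbourhood of the identity can be shrunk so that the translates of a polynomial
function span a finite-dimensional space which is stable under a neighbourhood of the identity. -/
theorem IsPolynomialFunction.exists_invariant_submodule {ξ : C_c(G, ℂ)}
    (hξ : IsPolynomialFunction ξ) :
    ∃ F : Submodule ℂ C_c(G, ℂ), FiniteDimensional ℂ F ∧ ξ ∈ F ∧
      ∀ᶠ v in 𝓝 (1 : G), ∀ η ∈ F, rightTranslate v η ∈ F := by
  obtain ⟨V₀, hV₀, h1V₀, F₀, hF₀, hVF₀⟩ := hξ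
  let T : Set G → Submodule ℂ C_c(G, ℂ) := fun V ↦
    Submodule.span ℂ ((fun v ↦ rightTranslate v ξ) '' V)
  have hT : ∀ {V W : Set G}, V ⊆ W → T V ≤ T W := fun h ↦ Submodule.span_mono (image_mono h)
  have hfin : ∀ V ⊆ V₀, FiniteDimensional ℂ (T V) := by
    intro V hV
    refine Submodule.finiteDimensional_of_le (S₂ := F₀) (Submodule.span_le.mpr ?_)
    rintro _ ⟨v, hv, rfl⟩
    exact hVF₀ v (hV hv)
  let S : Set (Set G) := {V | V ∈ 𝓝 (1 : G) ∧ V ⊆ V₀}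
  have hS : S.Nonempty := ⟨V₀, hV₀.mem_nhds h1V₀, subset_rfl⟩
  -- With `finrank` minimal at `U`, shrinking to `W` with `W * W ⊆ U` leaves the span unchanged, so
  -- translation by `W` maps `T U = T W` into `T U`.
  obtain ⟨U, ⟨hU, hUV₀⟩, hmin⟩ := exists_minimalFor_of_wellFoundedLT (· ∈ S)
    (fun V ↦ Module.finrank ℂ (T V)) hS
  obtain ⟨W, hW, hWU⟩ : ∃ W ∈ 𝓝 (1 : G), ∀ v ∈ W, ∀ w ∈ W, v * w ∈ U := by
    have h := (continuous_mul (M := G)).continuousAt (x := ((1 : G), (1 : G)))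
    have h' : (fun p : G × G ↦ p.1 * p.2) ⁻¹' U ∈ 𝓝 ((1 : G), (1 : G)) := h (by simpa using hU)
    rw [nhds_prod_eq, mem_prod_same_iff] at h'
    obtain ⟨W, hW, hWU⟩ := h'
    exact ⟨W, hW, fun v hv w hw ↦ hWU (mk_mem_prod hv hw)⟩
  have hWsub : W ⊆ U := fun w hw ↦ by simpa using hWU 1 (mem_of_mem_nhds hW) w hw
  have hWS : W ∈ S := ⟨hW, hWsub.trans hUV₀⟩
  have := hfin U hUV₀
  have hTW : T W = T U := Submodule.eq_of_le_of_finrank_le (hT hWsub)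
    (hmin hWS (Submodule.finrank_mono (hT hWsub)))
  refine ⟨T U, hfin U hUV₀, ?_, ?_⟩
  · exact Submodule.subset_span ⟨1, mem_of_mem_nhds hU, rightTranslate_one ξ⟩
  · filter_upwards [hW] with v hv
    suffices h : T W ≤ (T U).comap (rightTranslateLinearMap v) from
      fun η hη ↦ h (hTW ▸ hη)
    refine Submodule.span_le.mpr ?_
    rintro _ ⟨w, hw, rfl⟩
    exact Submodule.subset_span ⟨v * w, hWU v hv w hw, rightTranslate_mul v w ξ⟩

/-- The functions in a finite-dimensional subspace of `C_c(X)` are supported in a common compact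
set. -/
theorem exists_isCompact_forall_eq_zero {X : Type*} [TopologicalSpace X]
    (F : Submodule ℂ C_c(X, ℂ)) [FiniteDimensional ℂ F] :
    ∃ K : Set X, IsCompact K ∧ ∀ η ∈ F, ∀ x ∉ K, η x = 0 := by
  obtain ⟨s, hs⟩ := (Submodule.fg_iff_finiteDimensional F).mpr inferInstance
  refine ⟨⋃ η ∈ s, tsupport η, s.isCompact_biUnion fun η _ ↦ η.hasCompactSupport, ?_⟩
  intro η hη x hx
  rw [← hs] at hη
  induction hη using Submodule.span_induction with
  | mem η hη => exact image_eq_zero_of_notMem_tsupport fun h ↦ hx (mem_biUnion hη h)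
  | zero => rfl
  | add η θ _ _ h₁ h₂ => simp [h₁, h₂]
  | smul c η _ h => simp [h]

theorem IsPolynomialFunction.exists_isCompact_isOpen_subgroup {ξ : C_c(G, ℂ)}
    (hξ : IsPolynomialFunction ξ) (hne : ξ ≠ 0) :
    ∃ H : Subgroup G, IsCompact (H : Set G) ∧ IsOpen (H : Set G) := by
  obtain ⟨F, hF, hξF, hinv⟩ := hξ.exists_invariant_submodule
  obtain ⟨K, hK, hKF⟩ := exists_isCompact_forall_eq_zero F
  obtain ⟨x, hx⟩ : ∃ x, ξ x ≠ 0 := by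
    by_contra! h
    exact hne (CompactlySupportedContinuousMap.ext h)
  let H : Subgroup G :=
    -- Requiring both `g` and `g⁻¹` to preserve `F` makes closure under inverses immediate.
    { carrier := {g | ∀ η ∈ F, rightTranslate g η ∈ F ∧ rightTranslate g⁻¹ η ∈ F}
      one_mem' := fun η hη ↦ by simpa [rightTranslate_one] using hη
      mul_mem' := fun {a b} ha hb η hη ↦ by
        rw [mul_inv_rev, rightTranslate_mul, rightTranslate_mul]
        exact ⟨(ha _ (hb η hη).1).1, (hb _ (ha η hη).2).2⟩
      inv_mem' := fun {a} ha η hη ↦ by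
        rw [inv_inv]
        exact (ha η hη).symm }
  have hopen : IsOpen (H : Set G) := by
    refine H.isOpen_of_mem_nhds (g := 1) ?_
    have hinv' : ∀ᶠ v in 𝓝 (1 : G), ∀ η ∈ F, rightTranslate v⁻¹ η ∈ F :=
      (tendsto_inv (1 : G)).eventually (by simpa using hinv)
    filter_upwards [hinv, hinv'] with v h₁ h₂ η hη using ⟨h₁ η hη, h₂ η hη⟩
  refine ⟨H, ?_, hopen⟩
  -- For `g ∈ H`, the translate of `ξ` by `g⁻¹` lies in `F` and takes the value `ξ x ≠ 0` at `x *
  -- g`. Hence `x * g ∈ K`, that is, `H ⊆ x⁻¹ K`.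
  refine (hK.image (f := fun k ↦ x⁻¹ * k) (continuous_const_mul _)).of_isClosed_subset
    (H.isClosed_of_isOpen hopen) fun g hg ↦ ⟨x * g, ?_, by simp⟩
  by_contra hxg
  have := hKF _ (hg ξ hξF).2 (x * g) hxg
  exact hx (by simpa using this)

theorem haarConvolution_rightTranslate [MeasurableSpace G] (μ : Measure G) (f η : C_c(G, ℂ))
    (v p : G) :
    haarConvolution μ f (rightTranslate v η) p = haarConvolution μ f η (p * v) := by
  simp [haarConvolution, mul_assoc]

section Haar

variable [MeasurableSpace G] [BorelSpace G] (μ : Measure G)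

theorem integrable_haarConvolution_integrand [IsFiniteMeasureOnCompacts μ] (f η : C_c(G, ℂ))
    (p : G) : Integrable (fun q ↦ f q * η (q⁻¹ * p)) μ := by
  have hf := f.continuous
  have hη := η.continuous
  exact Continuous.integrable_of_hasCompactSupport (by fun_prop) f.hasCompactSupport.mul_right

/-- The space of solutions `η` of `f * η = η` which vanish outside `L`. -/
noncomputable def haarConvolutionFixedSubmodule [IsFiniteMeasureOnCompacts μ]
    (f : C_c(G, ℂ)) (L : Set G) : Submodule ℂ C_c(G, ℂ) where
  carrier := {η | haarConvolution μ f η = η ∧ ∀ x ∉ L, η x = 0}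
  zero_mem' := ⟨by ext; simp [haarConvolution], fun _ _ ↦ rfl⟩
  add_mem' := by
    rintro η θ ⟨h₁, h₂⟩ ⟨h₃, h₄⟩
    refine ⟨?_, fun x hx ↦ by simp [h₂ x hx, h₄ x hx]⟩
    ext p
    have h₁' := congrFun h₁ p
    have h₃' := congrFun h₃ p
    simp only [haarConvolution] at h₁' h₃'
    simp only [haarConvolution, CompactlySupportedContinuousMap.add_apply, mul_add]
    rw [integral_add (integrable_haarConvolution_integrand μ f η p)
      (integrable_haarConvolution_integrand μ f θ p), h₁', h₃']
  smul_mem' := by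
    rintro c η ⟨h₁, h₂⟩
    refine ⟨?_, fun x hx ↦ by simp [h₂ x hx]⟩
    ext p
    have h₁' := congrFun h₁ p
    simp only [haarConvolution] at h₁'
    simp only [haarConvolution, CompactlySupportedContinuousMap.smul_apply, smul_eq_mul,
      mul_left_comm _ c]
    rw [integral_const_mul, h₁']

/-- The modulus of continuity of the convolution of `f` with a function of sup norm at most one is
controlled by `f` alone. -/
theorem norm_haarConvolution_sub_le [μ.IsMulLeftInvariant] [IsFiniteMeasureOnCompacts μ]
    (f η : C_c(G, ℂ)) (hη : ∀ x, ‖η x‖ ≤ 1) (p p' : G) :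
    ‖haarConvolution μ f η p - haarConvolution μ f η p'‖ ≤
      ∫ q, ‖f (p * q) - f (p' * q)‖ ∂μ := by
  -- Left invariance moves the dependence on `x` from `η` to `f`.
  have hconv : ∀ x : G, haarConvolution μ f η x = ∫ q, f (x * q) * η q⁻¹ ∂μ := fun x ↦ by
    rw [haarConvolution, ← integral_mul_left_eq_self _ x]
    simp [mul_assoc]
  have hint : ∀ x : G, Integrable (fun q ↦ f (x * q) * η q⁻¹) μ := fun x ↦ by
    simpa [mul_assoc] using (integrable_haarConvolution_integrand μ f η x).comp_mul_left x
  have hf : Integrable f μ := f.continuous.integrable_of_hasCompactSupport f.hasCompactSupport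
  rw [hconv, hconv, ← integral_sub (hint p) (hint p')]
  simp only [← sub_mul]
  refine norm_integral_le_of_norm_le
    ((hf.comp_mul_left p).sub (hf.comp_mul_left p')).norm (Eventually.of_forall fun q ↦ ?_)
  rw [norm_mul]
  exact mul_le_of_le_one_right (norm_nonneg _) (hη _)

/-- Left translation is continuous in the `L¹` norm on `C_c(G)`. -/
theorem tendsto_integral_norm_sub_leftTranslate [LocallyCompactSpace G]
    [IsFiniteMeasureOnCompacts μ] (f : C_c(G, ℂ)) (p₀ : G) :
    Tendsto (fun p ↦ ∫ q, ‖f (p₀ * q) - f (p * q)‖ ∂μ) (𝓝 p₀) (𝓝 0) := by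
  have hfc := f.continuous
  obtain ⟨N, hN, hNp₀⟩ := exists_compact_mem_nhds p₀
  -- For `p ∈ N` all the integrands are supported in the single compact set `N⁻¹ * tsupport f`.
  have hcont : ContinuousOn (fun p ↦ ∫ q, ‖f (p₀ * q) - f (p * q)‖ ∂μ) N := by
    refine continuousOn_integral_of_compact_support (hN.inv.mul f.hasCompactSupport.isCompact)
      (Continuous.continuousOn (by fun_prop)) fun p q hp hq ↦ ?_
    have hzero : ∀ x ∈ N, f (x * q) = 0 := fun x hx ↦
      image_eq_zero_of_notMem_tsupport fun h ↦
        hq ⟨x⁻¹, inv_mem_inv.mpr hx, x * q, h, by simp⟩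
    simp [hzero p hp, hzero p₀ (mem_of_mem_nhds hNp₀)]
  simpa using (hcont.continuousAt hNp₀).tendsto

theorem finiteDimensional_haarConvolutionFixedSubmodule [LocallyCompactSpace G]
    [μ.IsMulLeftInvariant] [IsFiniteMeasureOnCompacts μ] (f : C_c(G, ℂ)) {L : Set G}
    (hL : IsCompact L) : FiniteDimensional ℂ (haarConvolutionFixedSubmodule μ f L) := by
  refine finiteDimensional_of_equicontinuous_unitBall _ hL (fun η hη ↦ hη.2) fun p₀ ↦ ?_
  rw [Metric.equicontinuousAt_iff_right]
  intro ε hε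
  filter_upwards [(tendsto_integral_norm_sub_leftTranslate μ f p₀).eventually (gt_mem_nhds hε)]
    with p hp
  rintro ⟨η, ⟨hη, -⟩, hη1⟩
  rw [dist_eq_norm]
  have := norm_haarConvolution_sub_le μ f η hη1 p₀ p
  rw [hη] at this
  exact this.trans_lt hp

theorem isPolynomialFunction_of_haarConvolution_eq [LocallyCompactSpace G]
    [μ.IsMulLeftInvariant] [IsFiniteMeasureOnCompacts μ] {f ξ : C_c(G, ℂ)}
    (h : haarConvolution μ f ξ = ξ) : IsPolynomialFunction ξ := by
  obtain ⟨N, hN, hN1⟩ := exists_compact_mem_nhds (1 : G)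
  refine ⟨interior N, isOpen_interior, mem_interior_iff_mem_nhds.mpr hN1,
    haarConvolutionFixedSubmodule μ f (tsupport ξ * N⁻¹),
    finiteDimensional_haarConvolutionFixedSubmodule μ f (ξ.hasCompactSupport.isCompact.mul hN.inv),
    fun v hv ↦ ⟨?_, fun x hx ↦ ?_⟩⟩
  · ext p
    rw [haarConvolution_rightTranslate, h, rightTranslate_apply]
  · refine image_eq_zero_of_notMem_tsupport (f := ξ) (x := x * v) fun hxv ↦ hx ?_
    exact ⟨x * v, hxv, v⁻¹, inv_mem_inv.mpr (interior_subset hv), by simp⟩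

end Haar

end Group

theorem proposition5p17 {G : Type*} [Group G] [TopologicalSpace G] [IsTopologicalGroup G]
    [LocallyCompactSpace G] [T2Space G] [MeasurableSpace G] [BorelSpace G]
    (μ : MeasureTheory.Measure G) [μ.IsHaarMeasure]
    (f ξ : C_c(G, ℂ)) (h : haarConvolution μ f ξ = ξ) :
    IsPolynomialFunction ξ ∧
      (ξ ≠ 0 → ∃ G₀ : Subgroup G, IsCompact (G₀ : Set G) ∧ IsOpen (G₀ : Set G)) :=
  ⟨isPolynomialFunction_of_haarConvolution_eq μ h,
    (isPolynomialFunction_of_haarConvolution_eq μ h).exists_isCompact_isOpen_subgroup⟩
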